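/- Let $I=[a,b]$ with $a<b$ be a compact interval of real numbers. For a map $f:I\to I$ and a positive integer $n$, a period-$n$ point of $f$ is a point $x\in I$ with $f^n(x)=x$ and $f^k(x)\neq x$ for $1\le k<n$. Let $\prec$ be the Sharkovsky ordering of the positive integers, $$3\prec5\prec7\prec\cdots\prec2\cdot3\prec2\cdot5\prec2\cdot7\prec\cdots\prec2^2\cdot3\prec2^2\cdot5\prec2^2\cdot7\prec\cdots\prec\cdots\prec2^3\prec2^2\prec2\prec1.$$ Then the following three statements hold. (1) If $f:I\to I$ is continuous and has a period-$m$ point, and if $m\prec n$, then $f$ has a period-$n$ point. (2) For each positive integer $n$ there is a continuous map $f:I\to I$ that has a period-$n$ point but has no period-$m$ point for any $m$ with $m\prec n$. Moreover, $f$ can be chosen to be a truncation of the tent map $T(x)=b-|2x-(a+b)|$ of $I$ (which is $1-|2x-1|$ if $I=[0,1]$), that is, $f(x)=\max\{p,\min\{q,T(x)\}\}$ for some $p\le q$ in $I$. (3) There is a continuous map $f:I\to I$ that has a period-$2^i$ point for every $i=0,1,2,\ldots$ and has no periodic point of any other least period. -/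

import Mathlib

/-- The Sharkovsky ordering `m ≺ n` of the positive integers:
`3 ≺ 5 ≺ 7 ≺ ⋯ ≺ 2·3 ≺ 2·5 ≺ ⋯ ≺ 2²·3 ≺ 2²·5 ≺ ⋯ ≺ 2³ ≺ 2² ≺ 2 ≺ 1`. -/
inductive SharkovskyLT : ℕ → ℕ → Prop
  | same_block (k p q : ℕ) (hp : Odd p) (hq : Odd q) (h3 : 3 ≤ p) (hpq : p < q) :
      SharkovskyLT (2 ^ k * p) (2 ^ k * q)
  | next_block (k l p q : ℕ) (hp : Odd p) (hq : Odd q) (h3p : 3 ≤ p) (h3q : 3 ≤ q) (hkl : k < l) :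
      SharkovskyLT (2 ^ k * p) (2 ^ l * q)
  | to_pow (k l p : ℕ) (hp : Odd p) (h3 : 3 ≤ p) :
      SharkovskyLT (2 ^ k * p) (2 ^ l)
  | pow_pow (k l : ℕ) (hlk : l < k) :
      SharkovskyLT (2 ^ k) (2 ^ l)

/-- `f` has a period-`n` point: a periodic point whose least (positive) period is `n`. -/
def HasPeriodPoint {X : Type*} (f : X → X) (n : ℕ) : Prop :=
  ∃ x ∈ Function.periodicPts f, Function.minimalPeriod f x = n

/-- The tent map of the interval `[a, b]`; for `[0, 1]` it is `x ↦ 1 - |2 * x - 1|`. -/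
def tentMap (a b x : ℝ) : ℝ := b - |2 * x - (a + b)|

/-- `f` is a truncation of the tent map of `[a, b]`: the tent map cut off at a lower level `p`
and at an upper level `q`. -/
def IsTruncatedTentMap {a b : ℝ} (f : Set.Icc a b → Set.Icc a b) : Prop :=
  ∃ p ∈ Set.Icc a b, ∃ q ∈ Set.Icc a b, p ≤ q ∧
    ∀ x : Set.Icc a b, (f x : ℝ) = max p (min q (tentMap a b x))

/-!
# Sharkovsky's theorem and its realization by truncated tent maps

**Forcing.** Let `f` be a continuous map of the line with a cycle of `m ≥ 3` points, `p` the least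
of them. Then some `v > p` and a fixed point `z > v` satisfy `f (f v) = p < v < z < f v`
(`exists_jump_of_three_le`). The greatest fixed point of `f ∘ f` in `[p, v]` has period `2`
(`HasPeriodPoint.two_of_three_le`). The least fixed point `w` of `f ∘ f` in `[v, z]` makes `[v, w)`
a repelling spiral (`IsSpiral`): there `f (f x) < x < w < f x`. For odd `m` a spiral supplies two
families of cycles.

* Odd `n > m`: `f^[m + 2] v = f^[m] p < v`, while odd iterates throw points near `w` over `w`, so
  the intermediate value theorem gives fixed points of `f^[m + 2]`, `f^[m + 4]`, … in `[v, w)`, and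
  the greatest fixed point of `f^[n]` has least period `n` (`IsSpiral.hasPeriodPoint_of_odd`).
* Even `2 * n ≥ 4`: since `m` is odd, `f ∘ f` runs through the whole cycle, so it throws some point
  of `[p, v)` over `w`. Thus `f ∘ f` has a horseshoe, with a point that spends all but one step of
  its period `n` in `[v, w)` (`IsSpiral.exists_loop`); its period under `f` is `2 * n`.

Passing to the iterates `f^[2 ^ k]` turns these facts into the whole ordering
(`HasPeriodPoint.of_sharkovskyLT`).

**Realization.** The tent map `T` has a cycle of period `3`, hence cycles of all periods, and only
finitely many of each period, because it is expanding. Cutting `T` off at a level `h` keeps the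
cycles below `h` and creates no others except possibly one through `h`. Hence, if period `m` forces
period `n`, a period-`m` cycle of a truncation that stays below the level comes with a lower
period-`n` cycle of `T` (`exists_lower_cycleTop`: truncate at the top of the given cycle). Truncating
at the lowest top of a period-`n` cycle therefore leaves no period that forces `n`. Truncating at the
supremum of these levels over all `n = 2 ^ i` leaves exactly the powers of two, because another
period would force yet another one, and only one cycle can pass through the level.
-/

open Function Set Filter Topology

/-! ### Periodic points of continuous maps of the line -/

theorem hasPeriodPoint_iff {X : Type*} {f : X → X} {n : ℕ} :
    HasPeriodPoint f n ↔ 0 < n ∧ ∃ x, minimalPeriod f x = n := by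
  constructor
  · rintro ⟨x, hx, rfl⟩
    exact ⟨minimalPeriod_pos_of_mem_periodicPts hx, x, rfl⟩
  · rintro ⟨hn, x, rfl⟩
    exact ⟨x, minimalPeriod_pos_iff_mem_periodicPts.1 hn, rfl⟩

theorem exists_fixed_of_lt_of_gt {g : ℝ → ℝ} (hg : Continuous g) {a b : ℝ} (hab : a ≤ b)
    (ha : a < g a) (hb : g b < b) : ∃ c ∈ Ioo a b, g c = c := by
  have h : ContinuousOn (fun x => x - g x) (Icc a b) := (continuous_id.sub hg).continuousOn
  obtain ⟨c, hc, h0⟩ := intermediate_value_Ioo hab h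
    (show (0 : ℝ) ∈ Ioo (a - g a) (b - g b) from ⟨by linarith, by linarith⟩)
  exact ⟨c, hc, by simp only at h0; linarith⟩

theorem exists_fixed_of_gt_of_lt {g : ℝ → ℝ} (hg : Continuous g) {a b : ℝ} (hab : a ≤ b)
    (ha : g a < a) (hb : b < g b) : ∃ c ∈ Ioo a b, g c = c := by
  have h : ContinuousOn (fun x => g x - x) (Icc a b) := (hg.sub continuous_id).continuousOn
  obtain ⟨c, hc, h0⟩ := intermediate_value_Ioo hab h
    (show (0 : ℝ) ∈ Ioo (g a - a) (g b - b) from ⟨by linarith, by linarith⟩)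
  exact ⟨c, hc, by simp only at h0; linarith⟩

/-- A cycle in a linear order has a least point, which lies below its whole forward orbit. -/
theorem exists_least_of_orbit {X : Type*} [LinearOrder X] {f : X → X} {n : ℕ} (hn : 0 < n) {x : X}
    (hx : minimalPeriod f x = n) :
    ∃ p, minimalPeriod f p = n ∧ ∀ k, p ≤ f^[k] p := by
  have hxp : x ∈ periodicPts f := minimalPeriod_pos_iff_mem_periodicPts.1 (hx ▸ hn)
  obtain ⟨i, -, hi⟩ := Finset.exists_min_image (Finset.range n) (fun k => f^[k] x)
    ⟨0, Finset.mem_range.2 hn⟩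
  refine ⟨f^[i] x, by rw [minimalPeriod_apply_iterate hxp, hx], fun k => ?_⟩
  rw [← iterate_add_apply, ← iterate_mod_minimalPeriod_eq (n := k + i), hx]
  exact hi _ (Finset.mem_range.2 (Nat.mod_lt _ hn))

/-- Around a cycle with at least three points there are `p < v < z`, where `p` is the least point
of the cycle, `z` is fixed, and `v` jumps over `z` and then lands on `p`. -/
theorem exists_jump_of_three_le {f : ℝ → ℝ} (hf : Continuous f) {m : ℕ} (hm : 3 ≤ m) {x : ℝ}
    (hx : minimalPeriod f x = m) :
    ∃ p v z, minimalPeriod f p = m ∧ (∀ k, p ≤ f^[k] p) ∧ p < v ∧ v < z ∧ f z = z ∧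
      z < f v ∧ f v = f^[m - 1] p ∧ f (f v) = p := by
  obtain ⟨p, hp, hmin⟩ := exists_least_of_orbit (by omega) hx
  have hne : ∀ k, 0 < k → k < m → f^[k] p ≠ p := fun k h0 h1 =>
    not_isPeriodicPt_of_pos_of_lt_minimalPeriod h0.ne' (hp ▸ h1)
  set b := f^[m - 1] p with hb
  have hfb : f b = p := by
    rw [hb, ← iterate_succ_apply' f, show (m - 1).succ = m by omega, ← hp]
    exact isPeriodicPt_minimalPeriod f p
  have hpb : p < b := lt_of_le_of_ne (hmin _) (hne _ (by omega) (by omega)).symm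
  obtain ⟨y, hy, hby⟩ : ∃ y ∈ Icc p b, b ≤ f y := by
    by_contra! h
    have : ∀ k, f^[k] p < b := by
      intro k
      induction k with
      | zero => exact hpb
      | succ k ih =>
        rw [iterate_succ_apply']
        exact h _ ⟨hmin k, ih.le⟩
    exact (this (m - 1)).ne rfl
  obtain ⟨v, hv, hfv⟩ := intermediate_value_Icc' hy.2 hf.continuousOn
    (show b ∈ Icc (f b) (f y) from ⟨hfb ▸ hpb.le, hby⟩)
  have hvb : v < b := lt_of_le_of_ne hv.2 (by rintro rfl; exact hpb.ne (hfb.symm.trans hfv))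
  have hpv : p < v := by
    refine lt_of_le_of_ne (hy.1.trans hv.1) ?_
    rintro rfl
    exact hne 2 (by norm_num) (by omega) (by simp [hfv, hfb])
  obtain ⟨z, hz, hfz⟩ := exists_fixed_of_lt_of_gt hf hvb.le (hfv ▸ hvb) (hfb ▸ hpb)
  exact ⟨p, v, z, hp, hmin, hpv, hz.1, hfz, hfv ▸ hz.2, hfv, by rw [hfv, hfb]⟩

theorem minimalPeriod_eq_two {f : ℝ → ℝ} {y : ℝ} (h2 : f (f y) = y) (h1 : f y ≠ y) :
    minimalPeriod f y = 2 :=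
  have : Fact (Nat.Prime 2) := ⟨Nat.prime_two⟩
  minimalPeriod_eq_prime h2 h1

theorem HasPeriodPoint.two_of_three_le {f : ℝ → ℝ} (hf : Continuous f) {m : ℕ} (hm : 3 ≤ m)
    (h : HasPeriodPoint f m) : HasPeriodPoint f 2 := by
  obtain ⟨-, x, hx⟩ := hasPeriodPoint_iff.1 h
  obtain ⟨p, v, z, hp, hmin, hpv, hvz, hz, hzv, -, hvp⟩ := exists_jump_of_three_le hf hm hx
  have hg : Continuous fun x => f (f x) := hf.comp hf
  have hpg : p < f (f p) := lt_of_le_of_ne (hmin 2) fun h =>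
    not_isPeriodicPt_of_pos_of_lt_minimalPeriod (f := f) (x := p) two_ne_zero (by omega) h.symm
  obtain ⟨y₀, hy₀, hgy₀⟩ := exists_fixed_of_lt_of_gt hg hpv.le hpg (by simp only [hvp]; exact hpv)
  have hcpt : IsCompact (Icc p v ∩ {x | f (f x) = x}) :=
    isCompact_Icc.inter_right (isClosed_eq hg continuous_id)
  obtain ⟨y, ⟨hy, hgy⟩, hmax⟩ := hcpt.exists_isGreatest ⟨y₀, Ioo_subset_Icc_self hy₀, hgy₀⟩
  refine hasPeriodPoint_iff.2 ⟨two_pos, y, minimalPeriod_eq_two hgy fun hfy => ?_⟩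
  have hyz : y < z := hy.2.trans_lt hvz
  obtain ⟨t, ht, hft⟩ := intermediate_value_Icc hy.2 hf.continuousOn
    (show z ∈ Icc (f y) (f v) from ⟨hfy.le.trans hyz.le, hzv.le⟩)
  -- `f (f t) = z > t` and `f (f v) < v`, so a fixed point of `f ∘ f` lies beyond `y`.
  obtain ⟨s, hs, hgs⟩ := exists_fixed_of_lt_of_gt hg ht.2
    (by simp only [hft, hz]; exact ht.2.trans_lt hvz) (by simp only [hvp]; exact hpv)
  have : s ≤ y := hmax ⟨⟨hy.1.trans (ht.1.trans hs.1.le), hs.2.le⟩, hgs⟩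
  linarith [hs.1, ht.1]

theorem HasPeriodPoint.one {f : ℝ → ℝ} (hf : Continuous f) {m : ℕ} (h : HasPeriodPoint f m) :
    HasPeriodPoint f 1 := by
  obtain ⟨hm, x, hx⟩ := hasPeriodPoint_iff.1 h
  obtain rfl | rfl | h3 : m = 1 ∨ m = 2 ∨ 3 ≤ m := by omega
  · exact h
  · obtain ⟨p, hp, hmin⟩ := exists_least_of_orbit hm hx
    have h2 : f (f p) = p := by
      have := isPeriodicPt_minimalPeriod f p
      rwa [hp] at this
    have h1 : p < f p := lt_of_le_of_ne (hmin 1) fun h =>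
      not_isPeriodicPt_of_pos_of_lt_minimalPeriod (f := f) (x := p) one_ne_zero (by omega) h.symm
    obtain ⟨c, -, hc⟩ := exists_fixed_of_lt_of_gt hf h1.le h1 (by rw [h2]; exact h1)
    exact hasPeriodPoint_iff.2 ⟨one_pos, c, minimalPeriod_eq_one_iff_isFixedPt.2 hc⟩
  · obtain ⟨-, -, z, -, -, -, -, hz, -⟩ := exists_jump_of_three_le hf h3 hx
    exact hasPeriodPoint_iff.2 ⟨one_pos, z, minimalPeriod_eq_one_iff_isFixedPt.2 hz⟩

/-! ### Odd periods -/

/-- `f` has a repelling spiral on `[v, w)`: the point `w` is fixed by `f ∘ f`, the map `f` throws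
`[v, w)` to the right of `w`, and `f ∘ f` moves every point of `[v, w)` away from `w`, to the
left. -/
structure IsSpiral (f : ℝ → ℝ) (v w : ℝ) : Prop where
  lt : v < w
  apply_apply_eq : f (f w) = w
  lt_apply : ∀ x ∈ Ico v w, w < f x
  apply_apply_lt : ∀ x ∈ Ico v w, f (f x) < x

theorem exists_isSpiral {f : ℝ → ℝ} (hf : Continuous f) {v z : ℝ} (hvz : v < z) (hz : f z = z)
    (hzv : z < f v) (hv : f (f v) < v) : ∃ w ≤ z, IsSpiral f v w := by
  have hg : Continuous fun x => f (f x) := hf.comp hf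
  have hcpt : IsCompact (Icc v z ∩ {x | f (f x) = x}) :=
    isCompact_Icc.inter_right (isClosed_eq hg continuous_id)
  obtain ⟨w, ⟨hw, hgw⟩, hmin⟩ := hcpt.exists_isLeast ⟨z, ⟨hvz.le, le_rfl⟩, by simp [hz]⟩
  have hlt : ∀ x ∈ Ico v w, f (f x) < x := by
    intro x hx
    by_contra! h
    have hne : ∀ y ∈ Icc v x, f (f y) ≠ y := fun y hy h' =>
      (hmin ⟨⟨hy.1, hy.2.trans (hx.2.le.trans hw.2)⟩, h'⟩).not_gt (hy.2.trans_lt hx.2)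
    obtain ⟨y, hy, hgy⟩ := exists_fixed_of_gt_of_lt hg hx.1 hv
      (lt_of_le_of_ne h (hne x ⟨hx.1, le_rfl⟩).symm)
    exact hne y (Ioo_subset_Icc_self hy) hgy
  refine ⟨w, hw.2, lt_of_le_of_ne hw.1 (by rintro rfl; exact hv.ne hgw), hgw, fun x hx => ?_, hlt⟩
  by_contra! h
  obtain ⟨y, hy, hfy⟩ := intermediate_value_Icc' hx.1 hf.continuousOn
    (show z ∈ Icc (f x) (f v) from ⟨h.trans hw.2, hzv.le⟩)
  have := hlt y ⟨hy.1, hy.2.trans_lt hx.2⟩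
  rw [hfy, hz] at this
  linarith [hy.2, hx.2, hw.2]

theorem iterate_two_mul_add_one {X : Type*} (f : X → X) (j : ℕ) (x : X) :
    f^[2 * j + 1] x = f ((f^[2])^[j] x) := by
  rw [iterate_succ_apply', iterate_mul]

namespace IsSpiral

variable {f : ℝ → ℝ} {v w : ℝ}

theorem eventually_mem (h : IsSpiral f v w) : ∀ᶠ u in 𝓝[<] w, u ∈ Ico v w := by
  filter_upwards [Ico_mem_nhdsLT h.lt] with u hu using hu

/-- The spiral moves away from `w` but only continuously so: odd iterates still throw points
close to `w` over `w`. -/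
theorem eventually_lt_iterate (h : IsSpiral f v w) (hf : Continuous f) {n : ℕ} (hn : Odd n) :
    ∀ᶠ u in 𝓝[<] w, w < f^[n] u := by
  obtain ⟨j, rfl⟩ := hn
  have ht : Tendsto (f^[2]) (𝓝[<] w) (𝓝[<] w) := by
    refine tendsto_nhdsWithin_iff.2 ⟨?_, ?_⟩
    · have : Tendsto (f^[2]) (𝓝 w) (𝓝 (f (f w))) := (hf.iterate 2).tendsto w
      rw [h.apply_apply_eq] at this
      exact this.mono_left nhdsWithin_le_nhds
    · filter_upwards [h.eventually_mem] with u hu using (h.apply_apply_lt u hu).trans hu.2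
  filter_upwards [(ht.iterate j).eventually h.eventually_mem] with u hu
  rw [iterate_two_mul_add_one]
  exact h.lt_apply _ hu

theorem exists_fixed (h : IsSpiral f v w) (hf : Continuous f) {n : ℕ} (hn : Odd n) {q : ℝ}
    (hq : q ∈ Ico v w) (hlt : f^[n] q < q) : ∃ r ∈ Ioo q w, f^[n] r = r := by
  obtain ⟨u, hu, hqu⟩ := ((h.eventually_lt_iterate hf hn).and
    (Ioo_mem_nhdsLT hq.2)).exists
  obtain ⟨r, hr, hfr⟩ := exists_fixed_of_gt_of_lt (hf.iterate n) hqu.1.le hlt (hqu.2.trans hu)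
  exact ⟨r, ⟨hr.1, hr.2.trans hqu.2⟩, hfr⟩

theorem exists_fixed_add (h : IsSpiral f v w) (hf : Continuous f) {n : ℕ} (hn : Odd n) {q : ℝ}
    (hq : q ∈ Ico v w) (hlt : f^[n] q < q) (i : ℕ) :
    ∃ r ∈ Ioo q w, f^[n + 2 * i] r = r := by
  induction i with
  | zero => exact h.exists_fixed hf hn hq hlt
  | succ i ih =>
    obtain ⟨r, hr, hfr⟩ := ih
    have hr' : r ∈ Ico v w := ⟨hq.1.trans hr.1.le, hr.2⟩
    obtain ⟨s, hs, hfs⟩ := h.exists_fixed hf (n := n + 2 * (i + 1)) (hn.add_even (by simp)) hr' (by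
      rw [show n + 2 * (i + 1) = 2 + (n + 2 * i) by ring, iterate_add_apply, hfr]
      exact h.apply_apply_lt r hr')
    exact ⟨s, ⟨hr.1.trans hs.1, hs.2⟩, hfs⟩

/-- On a spiral, the greatest fixed point of `f^[n]` has least period exactly `n`: a smaller odd
period `k` would produce fixed points of `f^[k + 2]`, `f^[k + 4]`, …, `f^[n]` further right. -/
theorem hasPeriodPoint_of_odd (h : IsSpiral f v w) (hf : Continuous f) {n : ℕ} (hn : Odd n)
    {q : ℝ} (hq : q ∈ Ico v w) (hfq : f^[n] q = q) : HasPeriodPoint f n := by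
  obtain ⟨l, hl, hlw⟩ := (mem_nhdsLT_iff_exists_Ioo_subset' h.lt).1
    (h.eventually_lt_iterate hf hn)
  have hcpt : IsCompact (Icc v l ∩ {x | f^[n] x = x}) :=
    isCompact_Icc.inter_right (isClosed_eq (hf.iterate n) continuous_id)
  have hle : ∀ x ∈ Ico v w, f^[n] x = x → x ≤ l := fun x hx hfx => by
    by_contra! hlx
    have : w < f^[n] x := hlw ⟨hlx, hx.2⟩
    linarith [hx.2]
  obtain ⟨r, ⟨hr, hfr⟩, hmax⟩ := hcpt.exists_isGreatest ⟨q, ⟨hq.1, hle q hq hfq⟩, hfq⟩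
  have hrw : r ∈ Ico v w := ⟨hr.1, hr.2.trans_lt hl⟩
  have hdvd : minimalPeriod f r ∣ n := IsPeriodicPt.minimalPeriod_dvd hfr
  refine hasPeriodPoint_iff.2 ⟨hn.pos, r, ?_⟩
  by_contra hne
  have hodd := Odd.of_dvd_nat hn hdvd
  obtain ⟨i, hi⟩ : ∃ i, n = minimalPeriod f r + 2 + 2 * i := by
    have := Nat.le_of_dvd hn.pos hdvd
    obtain ⟨a, ha⟩ := hn
    obtain ⟨b, hb⟩ := hodd
    exact ⟨a - b - 1, by omega⟩
  obtain ⟨s, hs, hfs⟩ := h.exists_fixed_add hf (n := minimalPeriod f r + 2)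
    (hodd.add_even (by simp)) hrw (by
      rw [add_comm, iterate_add_apply, iterate_minimalPeriod]
      exact h.apply_apply_lt r hrw) i
  rw [← hi] at hfs
  have hsw : s ∈ Ico v w := ⟨hr.1.trans hs.1.le, hs.2⟩
  exact (hmax ⟨⟨hsw.1, hle s hsw hfs⟩, hfs⟩).not_gt hs.1

/-- A horseshoe for `f ∘ f`: if `c < v` is thrown over `w` by `f ∘ f`, and `v` is thrown to the left
of `c`, then there is a point left of `v` whose next `i + 1` iterates under `f ∘ f` lie in
`[v, w)` and which then returns to itself. -/
theorem exists_loop (h : IsSpiral f v w) (hf : Continuous f) {c : ℝ} (hcv : c < v)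
    (hc : w ≤ f (f c)) (hv : f (f v) ≤ c) (i : ℕ) :
    ∃ x < v, (f^[2])^[i + 2] x = x ∧ ∀ j ∈ Icc 1 (i + 1), (f^[2])^[j] x ∈ Ico v w := by
  set g := f^[2] with hgdef
  have hg : Continuous g := hf.iterate 2
  have hgw : g w = w := h.apply_apply_eq
  obtain ⟨t₀, ht₀, hgt₀⟩ := intermediate_value_Icc' hcv.le hg.continuousOn
    (show w ∈ Icc (g v) (g c) from ⟨hv.trans (hcv.le.trans h.lt.le), hc⟩)
  have hcpt : IsCompact (Icc c v ∩ {x | g x = w}) :=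
    isCompact_Icc.inter_right (isClosed_eq hg continuous_const)
  obtain ⟨t, ⟨ht, hgt : g t = w⟩, hmax⟩ := hcpt.exists_isGreatest ⟨t₀, ht₀, hgt₀⟩
  have htv : t < v := by
    refine lt_of_le_of_ne ht.2 ?_
    rintro rfl
    have : w ≤ c := hgt ▸ hv
    linarith [h.lt]
  have hlt : ∀ x ∈ Ioc t v, g x < w := by
    intro x hx
    by_contra! hwx
    obtain ⟨y, hy, hgy⟩ := intermediate_value_Icc' hx.2 hg.continuousOn
      (show w ∈ Icc (g v) (g x) from ⟨hv.trans (hcv.le.trans h.lt.le), hwx⟩)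
    have : y ≤ t := hmax ⟨⟨ht.1.trans (hx.1.le.trans hy.1), hy.2⟩, hgy⟩
    linarith [hx.1, hy.1]
  have hgt' : ∀ j, g^[j + 1] t = w := by
    intro j
    rw [iterate_succ_apply, hgt]
    exact iterate_fixed hgw j
  -- The points `e` come closer to `t` at every step: the next one is the first point beyond `t`
  -- that the next iterate sends to `v`.
  have key : ∀ i, ∃ e ∈ Ioc t v, g^[i + 1] e = v ∧
      ∀ x ∈ Ioc t e, ∀ j ∈ Icc 1 (i + 1), g^[j] x ∈ Ico v w := by
    have step : ∀ i, ∀ e₀ ∈ Ioc t v, g^[i + 1] e₀ ≤ v → (∀ x ∈ Ioc t e₀, g^[i + 1] x < w) →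
        ∃ e ∈ Ioc t e₀, g^[i + 1] e = v ∧ ∀ x ∈ Ioc t e, g^[i + 1] x ∈ Ico v w := by
      intro i e₀ he₀ hle hw
      have hgi := hg.iterate (i + 1)
      obtain ⟨y, hy, hgy⟩ := intermediate_value_Icc' he₀.1.le hgi.continuousOn
        (show v ∈ Icc (g^[i + 1] e₀) (g^[i + 1] t) from ⟨hle, by rw [hgt']; exact h.lt.le⟩)
      have hcpt : IsCompact (Icc t e₀ ∩ {x | g^[i + 1] x = v}) :=
        isCompact_Icc.inter_right (isClosed_eq hgi continuous_const)
      obtain ⟨e, ⟨he, hge⟩, hmin⟩ := hcpt.exists_isLeast ⟨y, hy, hgy⟩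
      have hte : t < e := by
        refine lt_of_le_of_ne he.1 ?_
        rintro rfl
        exact h.lt.ne' ((hgt' i).symm.trans hge)
      refine ⟨e, ⟨hte, he.2⟩, hge, fun x hx => ⟨?_, hw x ⟨hx.1, hx.2.trans he.2⟩⟩⟩
      by_contra! hxv
      obtain ⟨s, hs, hgs⟩ := intermediate_value_Icc' hx.1.le hgi.continuousOn
        (show v ∈ Icc (g^[i + 1] x) (g^[i + 1] t) from ⟨hxv.le, by rw [hgt']; exact h.lt.le⟩)
      have hes : e ≤ s := hmin ⟨⟨hs.1, hs.2.trans (hx.2.trans he.2)⟩, hgs⟩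
      obtain rfl : s = x := le_antisymm hs.2 (hx.2.trans hes)
      exact hxv.ne hgs
    intro i
    induction i with
    | zero =>
      obtain ⟨e, he, hge, hx⟩ := step 0 v ⟨htv, le_rfl⟩ (hv.trans hcv.le) hlt
      refine ⟨e, he, hge, fun x hx' j hj => ?_⟩
      obtain rfl : j = 1 := le_antisymm hj.2 hj.1
      exact hx x hx'
    | succ i ih =>
      obtain ⟨e₀, he₀, hge₀, hx₀⟩ := ih
      obtain ⟨e, he, hge, hx⟩ := step (i + 1) e₀ he₀
        (by rw [iterate_succ_apply', hge₀]; exact hv.trans hcv.le)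
        (fun x hx => by
          have := hx₀ x hx (i + 1) ⟨by omega, le_rfl⟩
          rw [iterate_succ_apply']
          exact (h.apply_apply_lt _ this).trans this.2)
      refine ⟨e, ⟨he.1, he.2.trans he₀.2⟩, hge, fun x hx' j hj => ?_⟩
      obtain hj' | rfl : j ≤ i + 1 ∨ j = i + 1 + 1 := by have := hj.2; omega
      · exact hx₀ x ⟨hx'.1, hx'.2.trans he.2⟩ j ⟨hj.1, hj'⟩
      · exact hx x hx'
  obtain ⟨e, he, hge, hx⟩ := key i
  obtain ⟨x, hxt, hgx⟩ := exists_fixed_of_lt_of_gt (hg.iterate (i + 2)) he.1.le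
    (by rw [hgt']; exact htv.trans h.lt)
    (by rw [iterate_succ_apply', hge]; exact hv.trans_lt (ht.1.trans_lt he.1))
  exact ⟨x, hxt.2.trans_le he.2, hgx, hx x ⟨hxt.1, hxt.2.le⟩⟩

theorem hasPeriodPoint_two_mul (h : IsSpiral f v w) (hf : Continuous f) {c : ℝ} (hcv : c < v)
    (hc : w ≤ f (f c)) (hv : f (f v) ≤ c) {n : ℕ} (hn : 2 ≤ n) : HasPeriodPoint f (2 * n) := by
  obtain ⟨i, rfl⟩ : ∃ i, n = i + 2 := ⟨n - 2, by omega⟩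
  obtain ⟨x, hxv, hgx, hx⟩ := h.exists_loop hf hcv hc hv i
  have hper : minimalPeriod (f^[2]) x = i + 2 := by
    have hp : IsPeriodicPt (f^[2]) (i + 2) x := hgx
    refine le_antisymm (hp.minimalPeriod_le (by omega)) ?_
    by_contra! hlt
    have hpos := hp.minimalPeriod_pos (by omega)
    have := (hx _ ⟨hpos, by omega⟩).1
    rw [iterate_minimalPeriod] at this
    linarith
  have hf2 : IsPeriodicPt f (2 * (i + 2)) x := by
    unfold IsPeriodicPt IsFixedPt
    rw [iterate_mul]
    exact hgx
  have hpos : 0 < minimalPeriod f x := hf2.minimalPeriod_pos (by omega)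
  rw [minimalPeriod_iterate_eq_div_gcd two_ne_zero] at hper
  refine hasPeriodPoint_iff.2 ⟨by omega, x, ?_⟩
  rcases Nat.even_or_odd (minimalPeriod f x) with he | ho
  · rw [Nat.gcd_eq_right he.two_dvd] at hper
    have := he.two_dvd
    omega
  · rw [Nat.Coprime.gcd_eq_one (Nat.coprime_two_right.2 ho), Nat.div_one] at hper
    -- An odd period `n` would identify `f (f x) < w` with `f^[n + 2] x`, an image of a point
    -- of `[v, w)` under `f`.
    exfalso
    obtain ⟨a, ha⟩ := ho
    have h1 := (hx 1 ⟨le_rfl, by omega⟩).2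
    have h2 := h.lt_apply _ (hx (a + 1) ⟨by omega, by omega⟩)
    rw [← iterate_two_mul_add_one f, show 2 * (a + 1) + 1 = 2 + minimalPeriod f x by omega,
      iterate_add_apply, iterate_minimalPeriod] at h2
    exact lt_asymm h1 h2

end IsSpiral

theorem HasPeriodPoint.of_odd {f : ℝ → ℝ} (hf : Continuous f) {m n : ℕ} (hm : Odd m) (h3 : 3 ≤ m)
    (h : HasPeriodPoint f m) (hn : Even n ∨ m < n) (hn0 : 0 < n) : HasPeriodPoint f n := by
  obtain ⟨-, x, hx⟩ := hasPeriodPoint_iff.1 h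
  obtain ⟨p, v, z, hp, hmin, hpv, hvz, hz, hzv, hvm, hvp⟩ := exists_jump_of_three_le hf h3 hx
  obtain ⟨w, hwz, hs⟩ := exists_isSpiral hf hvz hz hzv (hvp ▸ hpv)
  have hv : v ∈ Ico v w := ⟨le_rfl, hs.lt⟩
  have hfp : f^[m] p = p := by rw [← hp, iterate_minimalPeriod]
  rcases Nat.even_or_odd n with he | ho
  · obtain ⟨k, rfl⟩ := he.two_dvd
    obtain rfl | hk : k = 1 ∨ 2 ≤ k := by omega
    · exact h.two_of_three_le hf h3
    -- Since `m` is odd, `f ∘ f` carries `p` to `f v = f^[m - 1] p`, which lies beyond `w`.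
    obtain ⟨c, hpc, hcw, hc⟩ : ∃ c, p ≤ c ∧ c < w ∧ w ≤ f (f c) := by
      by_contra! hcon
      have hall : ∀ j, f^[2 * j] p < w := by
        intro j
        induction j with
        | zero => exact hpv.trans hs.lt
        | succ j ih =>
          rw [show 2 * (j + 1) = 2 + 2 * j by ring, iterate_add_apply]
          exact hcon _ (hmin _) ih
      obtain ⟨a, rfl⟩ := hm
      have h1 : f^[2 * a] p < w := hall a
      have h2 : f v = f^[2 * a] p := hvm
      linarith
    refine hs.hasPeriodPoint_two_mul hf (c := c) ?_ hc (hvp ▸ hpc) hk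
    by_contra! hvc
    exact (hs.apply_apply_lt c ⟨hvc, hcw⟩).not_ge (hcw.le.trans hc)
  · have hmn : m < n := hn.resolve_left (by simpa using ho)
    obtain ⟨i, hi⟩ : ∃ i, n = m + 2 + 2 * i := by
      obtain ⟨a, ha⟩ := hm
      obtain ⟨b, hb⟩ := ho
      exact ⟨b - a - 1, by omega⟩
    obtain ⟨r, hr, hfr⟩ := hs.exists_fixed_add hf (n := m + 2) (hm.add_even (by simp)) hv (by
      rw [iterate_add_apply]
      change f^[m] (f (f v)) < v
      rwa [hvp, hfp]) i
    exact hs.hasPeriodPoint_of_odd hf ho ⟨hr.1.le, hr.2⟩ (hi ▸ hfr)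

/-! ### Sharkovsky's ordering and forcing -/

/-- If an iterate of order `2 ^ k` has a point of period `n`, then so has `f`, up to a factor
`2 ^ j` with `j ≤ k`. -/
theorem HasPeriodPoint.exists_of_iterate {X : Type*} {f : X → X} {k n : ℕ}
    (h : HasPeriodPoint (f^[2 ^ k]) n) : ∃ j ≤ k, HasPeriodPoint f (2 ^ j * n) := by
  obtain ⟨hn, x, hx⟩ := hasPeriodPoint_iff.1 h
  rw [minimalPeriod_iterate_eq_div_gcd (by positivity)] at hx
  obtain ⟨j, hj, hjg⟩ := (Nat.dvd_prime_pow Nat.prime_two).1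
    (Nat.gcd_dvd_right (minimalPeriod f x) (2 ^ k))
  refine ⟨j, hj, hasPeriodPoint_iff.2 ⟨by positivity, x, ?_⟩⟩
  rw [← hx, ← hjg, Nat.mul_div_cancel' (Nat.gcd_dvd_left _ _)]

theorem HasPeriodPoint.of_iterate_of_even {X : Type*} {f : X → X} {k n : ℕ}
    (h : HasPeriodPoint (f^[2 ^ k]) n) (hn : Even n) : HasPeriodPoint f (2 ^ k * n) := by
  obtain ⟨hn0, x, hx⟩ := hasPeriodPoint_iff.1 h
  rw [minimalPeriod_iterate_eq_div_gcd (by positivity)] at hx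
  set N := minimalPeriod f x
  obtain ⟨j, hj, hjg⟩ := (Nat.dvd_prime_pow Nat.prime_two).1 (Nat.gcd_dvd_right N (2 ^ k))
  have hN : N = 2 ^ j * n := by rw [← hx, ← hjg, Nat.mul_div_cancel' (Nat.gcd_dvd_left _ _)]
  obtain rfl | hlt := hj.eq_or_lt
  · exact hasPeriodPoint_iff.2 ⟨by positivity, x, hN⟩
  · -- For `j < k` the even number `n` would contribute a further factor `2` to the gcd.
    have hdvd : 2 ^ (j + 1) ∣ N.gcd (2 ^ k) :=
      Nat.dvd_gcd (by rw [hN, pow_succ]; exact mul_dvd_mul_left _ hn.two_dvd)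
        (pow_dvd_pow 2 hlt)
    rw [hjg, Nat.pow_dvd_pow_iff_le_right (by norm_num)] at hdvd
    omega

theorem HasPeriodPoint.iterate {X : Type*} {f : X → X} {k n : ℕ}
    (h : HasPeriodPoint f (2 ^ k * n)) : HasPeriodPoint (f^[2 ^ k]) n := by
  obtain ⟨hn, x, hx⟩ := hasPeriodPoint_iff.1 h
  refine hasPeriodPoint_iff.2 ⟨Nat.pos_of_mul_pos_left hn, x, ?_⟩
  rw [minimalPeriod_iterate_eq_div_gcd (by positivity), hx, Nat.gcd_eq_right (dvd_mul_right _ _),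
    Nat.mul_div_cancel_left _ (by positivity)]

/-- A period with an odd factor `p ≥ 3` forces its `2`-power part times any even number. -/
theorem HasPeriodPoint.two_pow_mul_of_even {f : ℝ → ℝ} (hf : Continuous f) {k p n : ℕ}
    (hp : Odd p) (h3 : 3 ≤ p) (h : HasPeriodPoint f (2 ^ k * p)) (hn : Even n) (hn0 : 0 < n) :
    HasPeriodPoint f (2 ^ k * n) :=
  (HasPeriodPoint.of_odd (hf.iterate _) hp h3 h.iterate (.inl hn) hn0).of_iterate_of_even hn

theorem HasPeriodPoint.two_pow_of_le {f : ℝ → ℝ} (hf : Continuous f) {k l p : ℕ} (hlk : l ≤ k)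
    (hp : 3 ≤ p ∨ l < k) (hp1 : 1 ≤ p) (h : HasPeriodPoint f (2 ^ k * p)) :
    HasPeriodPoint f (2 ^ l) := by
  cases l with
  | zero => exact h.one hf
  | succ l =>
    have hk : 2 ^ k * p = 2 ^ l * (2 ^ (k - l) * p) := by
      rw [← mul_assoc, ← pow_add, Nat.add_sub_cancel' (by omega)]
    rw [hk] at h
    refine (h.iterate.two_of_three_le (hf.iterate _) ?_).of_iterate_of_even even_two
    rcases hp with hp | hp
    · exact hp.trans (Nat.le_mul_of_pos_left _ (by positivity))
    · have : 2 ^ 2 ≤ 2 ^ (k - l) := Nat.pow_le_pow_right two_pos (by omega)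
      nlinarith

theorem HasPeriodPoint.of_sharkovskyLT_real {f : ℝ → ℝ} (hf : Continuous f) {m n : ℕ}
    (h : HasPeriodPoint f m) (hmn : SharkovskyLT m n) : HasPeriodPoint f n := by
  cases hmn with
  | same_block k p q hp hq h3 hpq =>
    have hq' := HasPeriodPoint.of_odd (hf.iterate _) hp h3 h.iterate (.inr hpq) (by omega)
    obtain ⟨j, hj, hjq⟩ := hq'.exists_of_iterate
    obtain rfl | hlt := hj.eq_or_lt
    · exact hjq
    · have := hjq.two_pow_mul_of_even hf (n := 2 ^ (k - j) * q) hq (by omega)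
        ((even_two.pow_of_ne_zero (by omega)).mul_right q) (by have := hq.pos; positivity)
      rwa [← mul_assoc, ← pow_add, Nat.add_sub_cancel' hj] at this
  | next_block k l p q hp hq h3p h3q hkl =>
    have := h.two_pow_mul_of_even hf (n := 2 ^ (l - k) * q) hp h3p
      ((even_two.pow_of_ne_zero (by omega)).mul_right q) (by positivity)
    rwa [← mul_assoc, ← pow_add, Nat.add_sub_cancel' hkl.le] at this
  | to_pow k l p hp h3 =>
    obtain hlk | hkl := le_or_gt l k
    · exact h.two_pow_of_le hf hlk (.inl h3) (by omega)
    · have := h.two_pow_mul_of_even hf (n := 2 ^ (l - k)) hp h3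
        (even_two.pow_of_ne_zero (by omega)) (by positivity)
      rwa [← pow_add, Nat.add_sub_cancel' hkl.le] at this
  | pow_pow k l hlk =>
    exact HasPeriodPoint.two_pow_of_le hf (p := 1) hlk.le (.inr hlk) le_rfl (by rwa [mul_one])

theorem HasPeriodPoint.of_sharkovskyLT {a b : ℝ} (hab : a ≤ b) {f : Icc a b → Icc a b}
    (hf : Continuous f) {m n : ℕ} (h : HasPeriodPoint f m) (hmn : SharkovskyLT m n) :
    HasPeriodPoint f n := by
  set F : ℝ → ℝ := fun x => f (projIcc a b hab x) with hF
  have hFc : Continuous F := continuous_subtype_val.comp (hf.comp continuous_projIcc)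
  have hsemi : Semiconj ((↑) : Icc a b → ℝ) f F := fun x => by simp [hF, projIcc_val]
  have hper : ∀ x : Icc a b, minimalPeriod F x = minimalPeriod f x := fun x =>
    minimalPeriod_eq_minimalPeriod_iff.2 fun k => by
      rw [IsPeriodicPt, IsFixedPt, ← (hsemi.iterate_right k).eq x, Subtype.coe_inj]
      rfl
  obtain ⟨hm, x, hx⟩ := hasPeriodPoint_iff.1 h
  have := HasPeriodPoint.of_sharkovskyLT_real hFc
    (hasPeriodPoint_iff.2 ⟨hm, (x : ℝ), by rw [hper, hx]⟩) hmn
  obtain ⟨hn, y, hy⟩ := hasPeriodPoint_iff.1 this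
  -- A periodic point of `F` lies in the range of `F`, hence in the interval.
  have hyI : y ∈ Icc a b := by
    have h1 : F^[n - 1 + 1] y = y := by
      rw [Nat.sub_add_cancel hn, ← hy, iterate_minimalPeriod]
    rw [iterate_succ_apply'] at h1
    rw [← h1]
    exact Subtype.coe_prop _
  exact hasPeriodPoint_iff.2 ⟨hn, ⟨y, hyI⟩, by rw [← hper, hy]⟩

theorem sharkovskyLT_three {n : ℕ} (hn : 0 < n) (h3 : n ≠ 3) : SharkovskyLT 3 n := by
  obtain ⟨k, q, hq, rfl⟩ := Nat.exists_eq_two_pow_mul_odd hn.ne'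
  have h30 : (3 : ℕ) = 2 ^ 0 * 3 := rfl
  have hodd : Odd 3 := ⟨1, rfl⟩
  rw [h30]
  have hq3 : q = 1 ∨ 3 ≤ q := by obtain ⟨c, rfl⟩ := hq; omega
  rcases hq3 with rfl | hq3
  · rw [mul_one]; exact .to_pow 0 k 3 hodd le_rfl
  · rcases Nat.eq_zero_or_pos k with rfl | hk
    · exact .same_block 0 3 q hodd hq le_rfl (by omega)
    · exact .next_block 0 k 3 q hodd hq le_rfl hq3 hk

theorem two_pow_mul_odd_inj {k l p q : ℕ} (hp : Odd p) (hq : Odd q)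
    (h : 2 ^ k * p = 2 ^ l * q) : k = l ∧ p = q := by
  have key : ∀ {k p : ℕ}, Odd p → padicValNat 2 (2 ^ k * p) = k := fun {k p} hp => by
    have : Fact (Nat.Prime 2) := ⟨Nat.prime_two⟩
    rw [padicValNat.mul (by positivity) hp.pos.ne', padicValNat.prime_pow,
      padicValNat.eq_zero_of_not_dvd hp.not_two_dvd_nat, add_zero]
  have hkl : k = l := by rw [← key (k := k) hp, h, key hq]
  subst hkl
  exact ⟨rfl, Nat.eq_of_mul_eq_mul_left (by positivity) h⟩

theorem SharkovskyLT.ne {m n : ℕ} (h : SharkovskyLT m n) : m ≠ n := by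
  intro hmn
  cases h with
  | same_block k p q hp hq h3 hpq => exact hpq.ne (two_pow_mul_odd_inj hp hq hmn).2
  | next_block k l p q hp hq h3p h3q hkl => exact hkl.ne (two_pow_mul_odd_inj hp hq hmn).1
  | to_pow k l p hp h3 =>
    have := (two_pow_mul_odd_inj hp odd_one (by rwa [mul_one] : 2 ^ k * p = 2 ^ l * 1)).2
    omega
  | pow_pow k l hlk => exact hlk.ne' (Nat.pow_right_injective le_rfl hmn)

/-! ### Truncated maps -/

section Truncation

variable {X : Type*} [LinearOrder X]

/-- The map `T` cut off at the upper level `h`. -/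
def truncAt (T : X → X) (h x : X) : X := min h (T x)

/-- The period-`n` points of `f` that are the greatest point of their cycle (for `n = 0`: the
non-periodic points that are above their forward orbit). -/
def cycleTops (f : X → X) (n : ℕ) : Set X := {y | minimalPeriod f y = n ∧ ∀ k, f^[k] y ≤ y}

variable {T : X → X} {h y : X} {m n : ℕ}

theorem cycleTops_nonempty {f : X → X} (hf : HasPeriodPoint f n) : (cycleTops f n).Nonempty := by
  obtain ⟨hn, x, hx⟩ := hasPeriodPoint_iff.1 hf
  exact exists_least_of_orbit (X := Xᵒᵈ) hn hx

theorem minimalPeriod_congr_of_iterate {X : Type*} {f g : X → X} {y : X}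
    (hfg : ∀ k, f^[k] y = g^[k] y) :
    minimalPeriod f y = minimalPeriod g y :=
  minimalPeriod_eq_minimalPeriod_iff.2 fun k => by
    rw [IsPeriodicPt, IsFixedPt, hfg]
    rfl

/-- Truncation does not change cycles below the level of truncation. -/
theorem mem_cycleTops_truncAt (hy : y ∈ cycleTops T n) (hyh : y ≤ h) :
    y ∈ cycleTops (truncAt T h) n := by
  have hk : ∀ k, (truncAt T h)^[k] y = T^[k] y := fun k => by
    induction k with
    | zero => rfl
    | succ k ih =>
      have := (hy.2 (k + 1)).trans hyh
      rw [iterate_succ_apply'] at this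
      rw [iterate_succ_apply', iterate_succ_apply', ih, truncAt, min_eq_right this]
  exact ⟨(minimalPeriod_congr_of_iterate hk).trans hy.1, fun k => hk k ▸ hy.2 k⟩

/-- A cycle of the truncated map that stays strictly below the level is a cycle of `T`. -/
theorem mem_cycleTops_of_truncAt (hy : y ∈ cycleTops (truncAt T h) n) (hyh : y < h) :
    y ∈ cycleTops T n := by
  have hk : ∀ k, (truncAt T h)^[k] y = T^[k] y := fun k => by
    induction k with
    | zero => rfl
    | succ k ih =>
      have := (hy.2 (k + 1)).trans_lt hyh
      rw [iterate_succ_apply', truncAt, min_lt_iff, or_iff_right (lt_irrefl _)] at this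
      rw [iterate_succ_apply', iterate_succ_apply', ← ih, truncAt, min_eq_right this.le]
  exact ⟨(minimalPeriod_congr_of_iterate hk).symm.trans hy.1, fun k => hk k ▸ hy.2 k⟩

theorem le_of_mem_cycleTops_truncAt (hn : 0 < n) (hy : y ∈ cycleTops (truncAt T h) n) :
    y ≤ h := by
  have h1 : (truncAt T h)^[n - 1 + 1] y = y := by
    rw [Nat.sub_add_cancel hn, ← hy.1, iterate_minimalPeriod]
  rw [iterate_succ_apply'] at h1
  rw [← h1]
  exact min_le_left _ _

/-- Suppose that period `m` forces period `n ≠ m` for the truncations of `T`. If a truncation has a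
period-`m` cycle strictly below its level, then `T` has a period-`n` cycle that is lower still:
truncate `T` at the top `y` of the given cycle; the forced cycle avoids `y`. -/
theorem exists_lower_cycleTop (hm : 0 < m) (hn : 0 < n) (hmn : m ≠ n)
    (hforce : ∀ h, HasPeriodPoint (truncAt T h) m → HasPeriodPoint (truncAt T h) n)
    (hy : y ∈ cycleTops (truncAt T h) m) (hyh : y < h) : ∃ x ∈ cycleTops T n, x < y := by
  have hy' := mem_cycleTops_truncAt (mem_cycleTops_of_truncAt hy hyh) le_rfl
  obtain ⟨x, hx⟩ := cycleTops_nonempty (hforce y (hasPeriodPoint_iff.2 ⟨hm, y, hy'.1⟩))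
  have hxy : x < y := by
    refine lt_of_le_of_ne (le_of_mem_cycleTops_truncAt hn hx) ?_
    rintro rfl
    exact hmn (hy'.1.symm.trans hx.1)
  exact ⟨x, mem_cycleTops_of_truncAt hx hxy, hxy⟩

end Truncation

/-! ### The tent map -/

theorem tentMap_mem {a b x : ℝ} (hx : x ∈ Icc a b) : tentMap a b x ∈ Icc a b := by
  have : |2 * x - (a + b)| ≤ b - a := abs_le.2 ⟨by linarith [hx.1], by linarith [hx.2]⟩
  exact ⟨by unfold tentMap; linarith, by unfold tentMap; linarith [abs_nonneg (2 * x - (a + b))]⟩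

/-- The tent map as a self-map of its interval. -/
def tent (a b : ℝ) (x : Icc a b) : Icc a b := ⟨tentMap a b x, tentMap_mem x.2⟩

theorem continuous_tent (a b : ℝ) : Continuous (tent a b) := by
  unfold tent tentMap
  fun_prop

theorem abs_tentMap_sub {a b x y : ℝ} (h : 2 * x ≤ a + b ↔ 2 * y ≤ a + b) :
    |tentMap a b x - tentMap a b y| = 2 * |x - y| := by
  unfold tentMap
  by_cases hx : 2 * x ≤ a + b
  · rw [abs_of_nonpos (by linarith : 2 * x - (a + b) ≤ 0),
      abs_of_nonpos (by linarith [h.1 hx] : 2 * y - (a + b) ≤ 0), ← abs_two, ← abs_mul, abs_two]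
    congr 1
    ring
  · have hy := fun hy => hx (h.2 hy)
    simp only [not_le, imp_false] at hx hy
    rw [abs_sub_comm x y, abs_of_nonneg (by linarith : 0 ≤ 2 * x - (a + b)),
      abs_of_nonneg (by linarith : 0 ≤ 2 * y - (a + b)), ← abs_two, ← abs_mul, abs_two]
    congr 1
    ring

/-- The tent map is expanding on either half of the interval, so a point of period dividing `n` is
determined by the halves that its first `n` iterates visit. -/
theorem finite_fixed_iterate_tent (a b : ℝ) {n : ℕ} (hn : 0 < n) :
    {y | (tent a b)^[n] y = y}.Finite := by
  classical
  let code : Icc a b → Fin n → Bool := fun y i => decide (2 * ((tent a b)^[i] y : ℝ) ≤ a + b)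
  refine Set.Finite.of_finite_image (f := code) (toFinite _) fun x hx y hy hxy => ?_
  have hexp : ∀ i ≤ n,
      |((tent a b)^[i] x : ℝ) - (tent a b)^[i] y| = 2 ^ i * |(x : ℝ) - y| := by
    intro i
    induction i with
    | zero => intro _; simp
    | succ i ih =>
      intro hi
      have hc := congrFun hxy ⟨i, hi⟩
      simp only [code, decide_eq_decide] at hc
      rw [iterate_succ_apply', iterate_succ_apply', pow_succ', mul_assoc, ← ih (by omega)]
      exact abs_tentMap_sub hc
  have h := hexp n le_rfl
  rw [hx, hy] at h
  have h2 : (1 : ℝ) < 2 ^ n := one_lt_pow₀ one_lt_two hn.ne'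
  have h0 : |(x : ℝ) - y| = 0 := by nlinarith [abs_nonneg ((x : ℝ) - y)]
  exact Subtype.ext (sub_eq_zero.1 (abs_eq_zero.1 h0))

/-- The point at `2 / 7` of the interval has the orbit `2 / 7`, `4 / 7`, `6 / 7`. -/
theorem hasPeriodPoint_tent_three {a b : ℝ} (hab : a < b) : HasPeriodPoint (tent a b) 3 := by
  have hx : a + (b - a) * (2 / 7) ∈ Icc a b := ⟨by linarith, by linarith⟩
  have h1 : tentMap a b (a + (b - a) * (2 / 7)) = a + (b - a) * (4 / 7) := by
    rw [tentMap, abs_of_nonpos (by linarith)]; ring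
  have h2 : tentMap a b (a + (b - a) * (4 / 7)) = a + (b - a) * (6 / 7) := by
    rw [tentMap, abs_of_nonneg (by linarith)]; ring
  have h3 : tentMap a b (a + (b - a) * (6 / 7)) = a + (b - a) * (2 / 7) := by
    rw [tentMap, abs_of_nonneg (by linarith)]; ring
  have : Fact (Nat.Prime 3) := ⟨Nat.prime_three⟩
  refine hasPeriodPoint_iff.2 ⟨by norm_num, ⟨_, hx⟩, minimalPeriod_eq_prime ?_ ?_⟩
  · refine Subtype.ext ?_
    change tentMap a b (tentMap a b (tentMap a b _)) = _
    rw [h1, h2, h3]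
  · intro h
    have : tentMap a b (a + (b - a) * (2 / 7)) = _ := congrArg Subtype.val h
    rw [h1] at this
    linarith

theorem hasPeriodPoint_tent {a b : ℝ} (hab : a < b) {n : ℕ} (hn : 0 < n) :
    HasPeriodPoint (tent a b) n := by
  obtain rfl | h3 := eq_or_ne n 3
  · exact hasPeriodPoint_tent_three hab
  · exact (hasPeriodPoint_tent_three hab).of_sharkovskyLT hab.le (continuous_tent a b)
      (sharkovskyLT_three hn h3)

theorem exists_isLeast_cycleTops_tent {a b : ℝ} (hab : a < b) {n : ℕ} (hn : 0 < n) :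
    ∃ h, IsLeast (cycleTops (tent a b) n) h := by
  have hfin : (cycleTops (tent a b) n).Finite :=
    (finite_fixed_iterate_tent a b hn).subset fun y hy => by
      rw [mem_ofPred_eq, ← hy.1, iterate_minimalPeriod]
  obtain ⟨h, hh, hmin⟩ := hfin.exists_minimalFor id _
    (cycleTops_nonempty (hasPeriodPoint_tent hab hn))
  exact ⟨h, hh, fun y hy => (le_total h y).elim id fun hyh => hmin hy hyh⟩

theorem continuous_truncAt_tent {a b : ℝ} (h : Icc a b) : Continuous (truncAt (tent a b) h) :=
  continuous_const.min (continuous_tent a b)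

theorem isTruncatedTentMap_truncAt {a b : ℝ} (hab : a ≤ b) (h : Icc a b) :
    IsTruncatedTentMap (truncAt (tent a b) h) := by
  refine ⟨a, ⟨le_rfl, hab⟩, h, h.2, h.2.1, fun x => ?_⟩
  rw [max_eq_right (le_min h.2.1 (tentMap_mem x.2).1)]
  exact (Subtype.mono_coe _).map_min

theorem SharkovskyLT.pos {m n : ℕ} (h : SharkovskyLT m n) : 0 < m ∧ 0 < n := by
  cases h with
  | same_block k p q hp hq => exact ⟨by have := hp.pos; positivity, by have := hq.pos; positivity⟩
  | next_block k l p q hp hq =>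
    exact ⟨by have := hp.pos; positivity, by have := hq.pos; positivity⟩
  | to_pow k l p hp => exact ⟨by have := hp.pos; positivity, by positivity⟩
  | pow_pow k l => exact ⟨by positivity, by positivity⟩

theorem SharkovskyLT.exists_lower_cycleTop {a b : ℝ} (hab : a ≤ b) {m n : ℕ}
    (hmn : SharkovskyLT m n) {h y : Icc a b} (hy : y ∈ cycleTops (truncAt (tent a b) h) m)
    (hyh : y < h) : ∃ x ∈ cycleTops (tent a b) n, x < y :=
  _root_.exists_lower_cycleTop hmn.pos.1 hmn.pos.2 hmn.ne
    (fun h hm => hm.of_sharkovskyLT hab (continuous_truncAt_tent h) hmn) hy hyh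

/-- Truncating at the lowest top of a period-`n` cycle leaves no period that forces `n`. -/
theorem exists_truncAt_tent_period {a b : ℝ} (hab : a < b) {n : ℕ} (hn : 0 < n) :
    ∃ h, HasPeriodPoint (truncAt (tent a b) h) n ∧
      ∀ m, SharkovskyLT m n → ¬ HasPeriodPoint (truncAt (tent a b) h) m := by
  obtain ⟨h, hh, hmin⟩ := exists_isLeast_cycleTops_tent hab hn
  have hhn := mem_cycleTops_truncAt hh le_rfl
  refine ⟨h, hasPeriodPoint_iff.2 ⟨hn, h, hhn.1⟩, fun m hmn hm => ?_⟩
  obtain ⟨y, hy⟩ := cycleTops_nonempty hm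
  obtain rfl | hlt := (le_of_mem_cycleTops_truncAt hmn.pos.1 hy).eq_or_lt
  · exact hmn.ne (hy.1.symm.trans hhn.1)
  · obtain ⟨x, hx, hxy⟩ := hmn.exists_lower_cycleTop hab.le hy hlt
    exact (hmin hx).not_gt (hxy.trans hlt)

/-- Truncating at the supremum, over all `i`, of the lowest tops of the period-`2 ^ i` cycles
leaves exactly the periods `2 ^ i`. -/
theorem exists_truncAt_tent_two_pow {a b : ℝ} (hab : a < b) :
    ∃ h, ∀ n, HasPeriodPoint (truncAt (tent a b) h) n ↔ ∃ i, n = 2 ^ i := by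
  have : Fact (a ≤ b) := ⟨hab.le⟩
  choose t ht using fun i : ℕ => exists_isLeast_cycleTops_tent hab (n := 2 ^ i) (by positivity)
  have hlub : IsLUB (range t) (sSup (range t)) := isLUB_sSup _
  generalize sSup (range t) = h at hlub
  refine ⟨h, fun n => ⟨fun hn => ?_, ?_⟩⟩
  · -- A cycle with a period that forces all `2 ^ i` has to reach the level `h`.
    have htop : ∀ {m y}, y ∈ cycleTops (truncAt (tent a b) h) m →
        (∀ i, SharkovskyLT m (2 ^ i)) → y = h := by
      intro m y hy hm
      refine (le_of_mem_cycleTops_truncAt (hm 0).pos.1 hy).eq_of_not_lt fun hlt => hlt.not_ge ?_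
      refine hlub.2 ?_
      rintro _ ⟨i, rfl⟩
      obtain ⟨x, hx, hxy⟩ := (hm i).exists_lower_cycleTop hab.le hy hlt
      exact ((ht i).2 hx).trans hxy.le
    obtain ⟨k, p, hp, rfl⟩ :=
      Nat.exists_eq_two_pow_mul_odd (hasPeriodPoint_iff.1 hn).1.ne'
    obtain rfl | h3 : p = 1 ∨ 3 ≤ p := by obtain ⟨c, rfl⟩ := hp; omega
    · exact ⟨k, mul_one _⟩
    -- Only one cycle reaches `h`, but the period `2 ^ k * p` forces `2 ^ k * (p + 2)` as well.
    exfalso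
    have hp2 : Odd (p + 2) := hp.add_even even_two
    have hlt : SharkovskyLT (2 ^ k * p) (2 ^ k * (p + 2)) :=
      .same_block k p (p + 2) hp hp2 h3 (by omega)
    obtain ⟨y, hy⟩ := cycleTops_nonempty hn
    obtain ⟨y', hy'⟩ := cycleTops_nonempty
      (hn.of_sharkovskyLT hab.le (continuous_truncAt_tent h) hlt)
    obtain rfl := htop hy fun i => .to_pow k i p hp h3
    obtain rfl := htop hy' fun i => .to_pow k i (p + 2) hp2 (by omega)
    exact hlt.ne (hy.1.symm.trans hy'.1)
  · rintro ⟨i, rfl⟩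
    exact hasPeriodPoint_iff.2
      ⟨by positivity, t i, (mem_cycleTops_truncAt (ht i).1 (hlub.1 ⟨i, rfl⟩)).1⟩

theorem theorem4 (a b : ℝ) (hab : a < b) :
    (∀ f : Set.Icc a b → Set.Icc a b, Continuous f →
      ∀ m n : ℕ, HasPeriodPoint f m → SharkovskyLT m n → HasPeriodPoint f n) ∧
    (∀ n : ℕ, 0 < n →
      ∃ f : Set.Icc a b → Set.Icc a b, Continuous f ∧ IsTruncatedTentMap f ∧
        HasPeriodPoint f n ∧ ∀ m : ℕ, SharkovskyLT m n → ¬ HasPeriodPoint f m) ∧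
    (∃ f : Set.Icc a b → Set.Icc a b, Continuous f ∧
      ∀ n : ℕ, HasPeriodPoint f n ↔ ∃ i : ℕ, n = 2 ^ i) := by
  refine ⟨fun f hf m n hm hmn => hm.of_sharkovskyLT hab.le hf hmn, fun n hn => ?_, ?_⟩
  · obtain ⟨h, hhn, hh⟩ := exists_truncAt_tent_period hab hn
    exact ⟨_, continuous_truncAt_tent h, isTruncatedTentMap_truncAt hab.le h, hhn, hh⟩
  · obtain ⟨h, hh⟩ := exists_truncAt_tent_two_pow hab
    exact ⟨_, continuous_truncAt_tent h, hh⟩
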